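/- Let $\ell\ge 1$ be an integer and let $\phi_1,\dots,\phi_\ell:\mathbb{N}\to\mathbb{Z}$ be \emph{adequate} sequences, meaning that $\lim_{n\to\infty}|\phi_j(n)|=\infty$ for every $j\in\{1,\dots,\ell\}$ and that for all $a_1,\dots,a_\ell\in\mathbb{Z}$ the limit $\lim_{n\to\infty}\bigl|\sum_{j=1}^\ell a_j\phi_j(n)\bigr|$ exists and lies in $\{0,\infty\}$. Let $G$ be a subgroup of $\mathbb{Z}^\ell$. Let $\mathbb{T}=\mathbb{R}/\mathbb{Z}$, let $$A_G=\Bigl\{(\alpha_1,\dots,\alpha_\ell)\in\mathbb{T}^\ell : e^{2\pi i\sum_{j=1}^\ell a_j\alpha_j}=1\text{ for all }(a_1,\dots,a_\ell)\in G\Bigr\}$$ be the annihilator of $G$, and let $\lambda_G$ be the normalized Haar measure of $A_G$, viewed as a Borel probability measure on $\mathbb{T}^\ell$. Put $$A(\phi_1,\dots,\phi_\ell)=\Bigl\{(a_1,\dots,a_\ell)\in\mathbb{Z}^\ell : \lim_{n\to\infty}\sum_{j=1}^\ell a_j\phi_j(n)=0\Bigr\}.$$ For a unitary operator $U$ on a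 complex Hilbert space $\mathcal{H}$ and a strictly increasing sequence $(n_k)_{k\in\mathbb{N}}$ in $\mathbb{N}$, put $$H(U,(n_k))=\Bigl\{(a_1,\dots,a_\ell)\in\mathbb{Z}^\ell : \lim_{k\to\infty}\bigl\|U^{\sum_{j=1}^\ell a_j\phi_j(n_k)}f-f\bigr\|_{\mathcal{H}}=0\text{ for all }f\in\mathcal{H}\Bigr\}.$$ Sequences $\psi_1,\dots,\psi_c:\mathbb{N}\to\mathbb{Z}$ are called \emph{asymptotically linearly independent} if $\lim_{n\to\infty}\bigl|\sum_{r=1}^c a_r\psi_r(n)\bigr|=\infty$ for every $(a_1,\dots,a_c)\in\mathbb{Z}^c\setminus\{\vec 0\}$. The following statements are equivalent. (i) $G$ is a group of rigidity for $\phi_1,\dots,\phi_\ell$, that is, $G=H(U,(n_k))$ for some unitary operator $U$ on a complex Hilbert space and some strictly increasing sequence $(n_k)_{k\in\mathbb{N}}$ in $\mathbb{N}$. (ii) $A(\phi_1,\dots,\phi_\ell)\subseteq G$. (iii) There exist a Borel probability measure $\sigma$ on $\mathbb{T}$ and a strictly increasing sequence $(n_k)_{k\in\mathbb{N}}$ in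 $\mathbb{N}$ such that for every continuous $f:\mathbb{T}^\ell\to\mathbb{C}$ and every measurable $E\subseteq\mathbb{T}$, $$\lim_{k\to\infty}\int_{\mathbb{T}}\mathbf{1}_E(x)\,f(\phi_1(n_k)x,\dots,\phi_\ell(n_k)x)\,d\sigma(x)=\sigma(E)\int_{\mathbb{T}^\ell}f\,d\lambda_G.$$ (iv) There exist a Borel probability measure $\sigma$ on $\mathbb{T}$ and a strictly increasing sequence $(n_k)_{k\in\mathbb{N}}$ in $\mathbb{N}$ such that for every continuous $f:\mathbb{T}^\ell\to\mathbb{C}$, $$\lim_{k\to\infty}\int_{\mathbb{T}}f(\phi_1(n_k)x,\dots,\phi_\ell(n_k)x)\,d\sigma(x)=\int_{\mathbb{T}^\ell}f\,d\lambda_G.$$ (v) There exist $c\in\{1,\dots,\ell\}$, an integer $M\ge 1$, indices $1\le j_1<\dots<j_c\le\ell$ and a subgroup $\tilde G$ of $\mathbb{Z}^c$ such that: (a) $\phi_{j_1},\dots,\phi_{j_c}$ are asymptotically linearly independent; (b) for all $(d_1,\dots,d_\ell)\in\mathbb{Z}^\ell$ there is $(a_1,\dots,a_c)\in\mathbb{Z}^c$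 with $$\lim_{k\to\infty}\Bigl|\sum_{r=1}^c a_r\phi_{j_r}(k)-M\sum_{j=1}^\ell d_j\phi_j(k)\Bigr|=0;\qquad(*)$$ and (c) for all $(d_1,\dots,d_\ell)\in\mathbb{Z}^\ell$, one has $(d_1,\dots,d_\ell)\in G$ if and only if every $(a_1,\dots,a_c)\in\mathbb{Z}^c$ satisfying $(*)$ lies in $\tilde G$. -/

import Mathlib

open Filter Topology MeasureTheory

universe u

/-- The group `ℝ / ℤ`. -/
abbrev Torus : Type := AddCircle (1 : ℝ)

/-- The sequences `φ 1, …, φ ℓ` are adequate: each `|φ j|` tends to infinity, and for every integer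
linear combination the limit of its absolute value exists and is either `0` or infinity. -/
def Adequate {ℓ : ℕ} (φ : Fin ℓ → ℕ → ℤ) : Prop :=
  (∀ j, Tendsto (fun n => |φ j n|) atTop atTop) ∧
  ∀ a : Fin ℓ → ℤ,
    Tendsto (fun n => |∑ j, a j * φ j n|) atTop (𝓝 0) ∨
    Tendsto (fun n => |∑ j, a j * φ j n|) atTop atTop

/-- Asymptotic linear independence of finitely many integer sequences. -/
def AsymptoticallyLinearIndependent {ℓ : ℕ} (φ : Fin ℓ → ℕ → ℤ) : Prop :=
  ∀ a : Fin ℓ → ℤ, a ≠ 0 → Tendsto (fun n => |∑ j, a j * φ j n|) atTop atTop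

/-- The set `A(φ 1, …, φ ℓ)` of asymptotic linear relations. -/
def asymptoticRelations {ℓ : ℕ} (φ : Fin ℓ → ℕ → ℤ) : Set (Fin ℓ → ℤ) :=
  {a | Tendsto (fun n => ∑ j, a j * φ j n) atTop (𝓝 0)}

/-- The set `H(U, (n k))` for a unitary operator `U`. -/
def rigiditySet {ℓ : ℕ} (φ : Fin ℓ → ℕ → ℤ) {H : Type*} [NormedAddCommGroup H]
    [InnerProductSpace ℂ H] (U : H ≃ₗᵢ[ℂ] H) (n : ℕ → ℕ) : Set (Fin ℓ → ℤ) :=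
  {a | ∀ f : H,
    Tendsto (fun k => ‖(U ^ (∑ j, a j * φ j (n k))) f - f‖) atTop (𝓝 0)}

/-- `G` is a group of rigidity for `φ 1, …, φ ℓ`: there are a strictly increasing sequence `n k` and
a unitary operator `U` on a complex Hilbert space with `G = H(U, (n k))`. -/
def IsRigidityGroup {ℓ : ℕ} (φ : Fin ℓ → ℕ → ℤ) (G : AddSubgroup (Fin ℓ → ℤ)) : Prop :=
  ∃ n : ℕ → ℕ, StrictMono n ∧
    ∃ (H : Type u) (_ : NormedAddCommGroup H) (_ : InnerProductSpace ℂ H) (_ : CompleteSpace H)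
      (U : H ≃ₗᵢ[ℂ] H), (G : Set (Fin ℓ → ℤ)) = rigiditySet φ U n

/-- The annihilator of `G` in `(ℝ / ℤ) ^ ℓ`; here `AddCircle.toCircle x = e ^ (2 π i x)`. -/
def annihilator {ℓ : ℕ} (G : AddSubgroup (Fin ℓ → ℤ)) : AddSubgroup (Fin ℓ → Torus) where
  carrier := {α | ∀ a ∈ G, (AddCircle.toCircle (∑ j, a j • α j) : ℂ) = 1}
  zero_mem' := by
    intro a _
    simp
  add_mem' := by
    intro α β hα hβ a ha
    simp [smul_add, Finset.sum_add_distrib, AddCircle.toCircle_add, hα a ha, hβ a ha]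
  neg_mem' := by
    intro α hα a ha
    simp [Finset.sum_neg_distrib, AddCircle.toCircle_neg, hα a ha]

theorem isClosed_annihilator {ℓ : ℕ} (G : AddSubgroup (Fin ℓ → ℤ)) :
    IsClosed (annihilator G : Set (Fin ℓ → Torus)) := by
  have h : (annihilator G : Set (Fin ℓ → Torus)) =
      ⋂ a ∈ G, {α | (AddCircle.toCircle (∑ j, a j • α j) : ℂ) = 1} := by
    ext α
    simp [annihilator]
  rw [h]
  refine isClosed_biInter fun a _ => isClosed_eq ?_ continuous_const
  refine continuous_subtype_val.comp (AddCircle.continuous_toCircle.comp ?_)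
  exact continuous_finsetSum _ fun j _ => (continuous_apply j).zsmul (a j)

instance {ℓ : ℕ} (G : AddSubgroup (Fin ℓ → ℤ)) : CompactSpace (annihilator G) :=
  isCompact_iff_compactSpace.mp (isClosed_annihilator G).isCompact

/-- The normalized Haar measure of the annihilator of `G`, viewed as a Borel measure on
`(ℝ / ℤ) ^ ℓ`. -/
noncomputable def haarAnnihilator {ℓ : ℕ} (G : AddSubgroup (Fin ℓ → ℤ)) :
    Measure (Fin ℓ → Torus) :=
  (Measure.addHaarMeasure (⊤ : TopologicalSpace.PositiveCompacts (annihilator G))).map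
    Subtype.val

/-!
Write `A` for the group of asymptotic relations. Along `a ∈ A` the exponent `∑ j, a j * φ j n` is
eventually `0`, so `A` is contained in every group of rigidity; along `a ∉ A` it tends to infinity
in absolute value. The heart of the matter is the construction of a measure for a given `G ⊇ A`.

By the Riemann-Lebesgue lemma and Weyl's criterion, the points `(φ 1 n • y, …, φ ℓ n • y)`, for `y`
in a fixed small interval, equidistribute in the annihilator of `A` as `n → ∞`
(`Adequate.tendsto_integral_mul`). Hence for large `n` every point of the annihilator of `A`, in
particular every point of the smaller annihilator of `G`, can be approximated by moving any given
`x` slightly (`Adequate.eventually_forall_exists_dist_lt`). Successive moves, so small that they do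
not spoil what was achieved before, yield times `n k` and, for every sequence `ω` in the annihilator
of `G`, a point `X ω` whose multiples by `φ j (n k)` follow `ω k` (`Adequate.exists_tracking`). If
the `ω k` are independent and Haar distributed, the law of `X` is the required measure: a nontrivial
character at the points `ω k` is an orthonormal sequence, so by Bessel's inequality it tends weakly
to zero, also after restriction to any event (`Adequate.exists_measure_tendsto`).

Equidistribution with respect to `σ` turns multiplication by `e ^ (2 π i x)` on `L²(σ)` into a
unitary operator with group of rigidity exactly `G`: strong convergence of its powers to the
identity is convergence of the Fourier coefficients of `σ` to `1`
(`tendsto_mulCharacter_zpow_iff`), and by duality the Haar measure of the annihilator of `G` has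
Fourier coefficient `1` on `G` and `0` off `G`.

The description through independent sequences comes from a maximal asymptotically independent set
of indices, over which a common multiple of every `φ j` is an integer combination
(`exists_multiple_of_maximal`); it uses that the group `A` is saturated in `ℤ ^ ℓ`.
-/

/-! ### Characters of the torus and of the annihilator -/

theorem mFourier_eq_toCircle {ℓ : ℕ} (a : Fin ℓ → ℤ) (z : Fin ℓ → Torus) :
    UnitAddTorus.mFourier a z = (AddCircle.toCircle (∑ j, a j • z j) : ℂ) := by
  have h : ∀ s : Finset (Fin ℓ), (∏ j ∈ s, fourier (a j) (z j) : ℂ) =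
      (AddCircle.toCircle (∑ j ∈ s, a j • z j) : ℂ) := by
    classical
    intro s
    induction s using Finset.induction_on with
    | empty => simp
    | insert i s hi ih =>
      rw [Finset.prod_insert hi, Finset.sum_insert hi, ih, AddCircle.toCircle_add, fourier_apply]
      rfl
  exact h Finset.univ

theorem mFourier_zsmul {ℓ : ℕ} (a m : Fin ℓ → ℤ) (x : Torus) :
    UnitAddTorus.mFourier a (fun j => m j • x) = fourier (∑ j, a j * m j) x := by
  rw [mFourier_eq_toCircle, fourier_apply, Finset.sum_smul]
  simp only [smul_smul]

theorem norm_mFourier_apply {ℓ : ℕ} (a : Fin ℓ → ℤ) (z : Fin ℓ → Torus) :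
    ‖UnitAddTorus.mFourier a z‖ = 1 := by
  rw [mFourier_eq_toCircle]
  exact Circle.norm_coe _

theorem mFourier_eq_one_of_mem {ℓ : ℕ} {G : AddSubgroup (Fin ℓ → ℤ)} {a : Fin ℓ → ℤ} (ha : a ∈ G)
    (z : annihilator G) : UnitAddTorus.mFourier a (z : Fin ℓ → Torus) = 1 := by
  rw [mFourier_eq_toCircle]
  exact z.2 a ha

/-- The inclusion `ℚ / ℤ → ℝ / ℤ`. -/
noncomputable def ratToTorus : AddCircle (1 : ℚ) →+ Torus :=
  QuotientAddGroup.map _ _ (Rat.castHom ℝ).toAddMonoidHom (by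
    rw [AddSubgroup.zmultiples_le]
    exact AddSubgroup.mem_zmultiples_iff.mpr ⟨1, by simp⟩)

theorem ratToTorus_injective : Function.Injective ratToTorus := by
  rw [injective_iff_map_eq_zero]
  intro x hx
  induction x using QuotientAddGroup.induction_on with
  | H q =>
    have hx' : ((q : ℝ) : Torus) = 0 := hx
    obtain ⟨m, hm⟩ := (AddCircle.coe_eq_zero_iff (1 : ℝ)).mp hx'
    refine (AddCircle.coe_eq_zero_iff (1 : ℚ)).mpr ⟨m, ?_⟩
    simp only [zsmul_eq_mul, mul_one] at hm ⊢
    exact_mod_cast hm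

/-- Duality for subgroups of `ℤ ^ ℓ`: a vector outside `G` is detected by the annihilator of `G`.
The point is a character of `ℤ ^ ℓ / G` with values in `ℚ / ℤ`, evaluated at the unit vectors. -/
theorem exists_mem_annihilator_mFourier_ne_one {ℓ : ℕ} {G : AddSubgroup (Fin ℓ → ℤ)}
    {a : Fin ℓ → ℤ} (ha : a ∉ G) :
    ∃ α : annihilator G, UnitAddTorus.mFourier a (α : Fin ℓ → Torus) ≠ 1 := by
  classical
  have ha' : (QuotientAddGroup.mk a : (Fin ℓ → ℤ) ⧸ G) ≠ 0 := by
    rwa [Ne, QuotientAddGroup.eq_zero_iff]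
  obtain ⟨c, hc⟩ := CharacterModule.exists_character_apply_ne_zero_of_ne_zero ha'
  let χ : (Fin ℓ → ℤ) →+ Torus := (ratToTorus.comp c).comp (QuotientAddGroup.mk' G)
  have hχ : ∀ b : Fin ℓ → ℤ, ∑ j, b j • χ (Pi.single j 1) = χ b := by
    intro b
    conv_rhs => rw [← Finset.univ_sum_single b]
    rw [map_sum]
    refine Finset.sum_congr rfl fun j _ => ?_
    rw [← map_zsmul, ← Pi.single_smul]
    simp
  have hmem : (fun j => χ (Pi.single j 1)) ∈ annihilator G := by
    intro b hb
    have hb' : (QuotientAddGroup.mk' G) b = 0 := (QuotientAddGroup.eq_zero_iff b).mpr hb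
    have : χ b = 0 := by
      change ratToTorus (c ((QuotientAddGroup.mk' G) b)) = 0
      rw [hb', map_zero, map_zero]
    rw [hχ, this]
    simp
  refine ⟨⟨_, hmem⟩, fun h => hc (ratToTorus_injective ?_)⟩
  rw [mFourier_eq_toCircle] at h
  simp only [hχ] at h
  rw [map_zero]
  refine AddCircle.injective_toCircle one_ne_zero ?_
  rw [AddCircle.toCircle_zero]
  exact Subtype.ext h

/-! ### Haar measure of the annihilator -/

/-- The normalized Haar measure of the annihilator, on the annihilator itself. -/
noncomputable abbrev annihilatorHaar {ℓ : ℕ} (G : AddSubgroup (Fin ℓ → ℤ)) :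
    Measure (annihilator G) :=
  Measure.addHaarMeasure ⊤

instance {ℓ : ℕ} (G : AddSubgroup (Fin ℓ → ℤ)) : IsProbabilityMeasure (annihilatorHaar G) :=
  ⟨Measure.addHaarMeasure_self⟩

theorem integral_haarAnnihilator {ℓ : ℕ} (G : AddSubgroup (Fin ℓ → ℤ))
    {f : (Fin ℓ → Torus) → ℂ} (hf : Continuous f) :
    ∫ y, f y ∂(haarAnnihilator G) = ∫ z : annihilator G, f z ∂(annihilatorHaar G) :=
  integral_map measurable_subtype_coe.aemeasurable hf.aestronglyMeasurable

instance {ℓ : ℕ} (G : AddSubgroup (Fin ℓ → ℤ)) : IsProbabilityMeasure (haarAnnihilator G) :=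
  Measure.isProbabilityMeasure_map measurable_subtype_coe.aemeasurable

/-- Translation by a point of the annihilator on which the character is nontrivial multiplies the
integral by a number other than `1`. -/
theorem integral_mFourier_annihilatorHaar_of_notMem {ℓ : ℕ} {G : AddSubgroup (Fin ℓ → ℤ)}
    {a : Fin ℓ → ℤ} (ha : a ∉ G) :
    ∫ z : annihilator G, UnitAddTorus.mFourier a (z : Fin ℓ → Torus) ∂(annihilatorHaar G) = 0 := by
  obtain ⟨α, hα⟩ := exists_mem_annihilator_mFourier_ne_one ha
  have h := integral_add_right_eq_self (μ := annihilatorHaar G)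
    (fun z : annihilator G => UnitAddTorus.mFourier a (z : Fin ℓ → Torus)) α
  have hmul : ∀ z : annihilator G, UnitAddTorus.mFourier a ((z + α : annihilator G) : Fin ℓ → Torus)
      = UnitAddTorus.mFourier a (z : Fin ℓ → Torus) *
        UnitAddTorus.mFourier a (α : Fin ℓ → Torus) := by
    intro z
    simp only [mFourier_eq_toCircle, AddSubgroup.coe_add, Pi.add_apply, smul_add,
      Finset.sum_add_distrib, AddCircle.toCircle_add, Circle.coe_mul]
  simp only [hmul] at h
  rw [integral_mul_const] at h
  have h' : (∫ z : annihilator G, UnitAddTorus.mFourier a (z : Fin ℓ → Torus) ∂(annihilatorHaar G)) *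
      (UnitAddTorus.mFourier a (α : Fin ℓ → Torus) - 1) = 0 := by
    rw [mul_sub, h, mul_one, sub_self]
  exact (mul_eq_zero.mp h').resolve_right (sub_ne_zero.mpr hα)

theorem integral_mFourier_haarAnnihilator_of_notMem {ℓ : ℕ} {G : AddSubgroup (Fin ℓ → ℤ)}
    {a : Fin ℓ → ℤ} (ha : a ∉ G) :
    ∫ y, UnitAddTorus.mFourier a y ∂(haarAnnihilator G) = 0 := by
  rw [integral_haarAnnihilator G (UnitAddTorus.mFourier a).continuous]
  exact integral_mFourier_annihilatorHaar_of_notMem ha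

theorem integral_mFourier_haarAnnihilator_of_mem {ℓ : ℕ} {G : AddSubgroup (Fin ℓ → ℤ)}
    {a : Fin ℓ → ℤ} (ha : a ∈ G) :
    ∫ y, UnitAddTorus.mFourier a y ∂(haarAnnihilator G) = 1 := by
  rw [integral_haarAnnihilator G (UnitAddTorus.mFourier a).continuous]
  simp [mFourier_eq_one_of_mem ha]

/-! ### Weak convergence -/

/-- Bessel's inequality: an orthonormal family converges weakly to zero. -/
theorem Orthonormal.tendsto_inner_cofinite {ι E : Type*} [NormedAddCommGroup E]
    [InnerProductSpace ℂ E] {v : ι → E} (hv : Orthonormal ℂ v) (x : E) :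
    Tendsto (fun i => inner ℂ (v i) x) cofinite (𝓝 0) := by
  have h := (hv.inner_products_summable x).tendsto_cofinite_zero
  rw [tendsto_zero_iff_norm_tendsto_zero]
  have h2 := h.sqrt
  simpa [Real.sqrt_sq] using h2

/-- Weyl's criterion, weighted by an integrable function `g`: convergence of the integrals of all
continuous functions follows from convergence for the characters. -/
theorem tendsto_integral_of_tendsto_mFourier {ℓ : ℕ} {X : Type*} [MeasurableSpace X]
    {μ : Measure X} {g : X → ℂ} (hg : Integrable g μ) {F : ℕ → X → (Fin ℓ → Torus)}
    (hF : ∀ n, Measurable (F n)) {ν : Measure (Fin ℓ → Torus)} [IsProbabilityMeasure ν] (c : ℂ)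
    (h : ∀ a : Fin ℓ → ℤ, Tendsto (fun n => ∫ x, g x * UnitAddTorus.mFourier a (F n x) ∂μ) atTop
      (𝓝 (c * ∫ y, UnitAddTorus.mFourier a y ∂ν)))
    {f : (Fin ℓ → Torus) → ℂ} (hf : Continuous f) :
    Tendsto (fun n => ∫ x, g x * f (F n x) ∂μ) atTop (𝓝 (c * ∫ y, f y ∂ν)) := by
  have hint : ∀ (p : C((Fin ℓ → Torus), ℂ)) n, Integrable (fun x => g x * p (F n x)) μ := by
    intro p n
    refine hg.mul_bdd (c := ‖p‖) ((p.continuous.measurable.comp (hF n)).aestronglyMeasurable) ?_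
    exact Eventually.of_forall fun x => p.norm_coe_le_norm _
  have hintν : ∀ p : C((Fin ℓ → Torus), ℂ), Integrable (fun y => p y) ν := fun p =>
    Integrable.of_bound p.continuous.aestronglyMeasurable ‖p‖
      (Eventually.of_forall fun x => p.norm_coe_le_norm _)
  have hspan : ∀ p ∈ Submodule.span ℂ (Set.range (UnitAddTorus.mFourier (d := Fin ℓ))),
      Tendsto (fun n => ∫ x, g x * p (F n x) ∂μ) atTop (𝓝 (c * ∫ y, p y ∂ν)) := by
    intro p hp
    induction hp using Submodule.span_induction with
    | mem p hp => obtain ⟨a, rfl⟩ := hp; exact h a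
    | zero => simp
    | add p q _ _ hp hq =>
      have := hp.add hq
      simp only [ContinuousMap.add_apply, mul_add]
      rw [integral_add (hintν p) (hintν q), mul_add]
      refine this.congr fun n => ?_
      rw [integral_add (hint p n) (hint q n)]
    | smul r p _ hp =>
      have := hp.const_mul r
      simp only [ContinuousMap.smul_apply, smul_eq_mul, mul_left_comm _ r, integral_const_mul]
      exact this
  set C : ℝ := (∫ x, ‖g x‖ ∂μ) + ‖c‖ + 1 with hC
  have hC0 : 0 < C := by positivity
  obtain ⟨f', rfl⟩ : ∃ f' : C((Fin ℓ → Torus), ℂ), f = f' := ⟨⟨f, hf⟩, rfl⟩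
  rw [Metric.tendsto_atTop]
  intro ε hε
  have hcl : f' ∈ closure (Submodule.span ℂ (Set.range (UnitAddTorus.mFourier (d := Fin ℓ))) :
      Set C((Fin ℓ → Torus), ℂ)) := by
    rw [← Submodule.topologicalClosure_coe, UnitAddTorus.span_mFourier_closure_eq_top]
    trivial
  obtain ⟨p, hp, hpf⟩ := Metric.mem_closure_iff.mp hcl (ε / (2 * C)) (by positivity)
  obtain ⟨N, hN⟩ := Metric.tendsto_atTop.mp (hspan p hp) (ε / 2) (by positivity)
  refine ⟨N, fun n hn => ?_⟩
  rw [dist_eq_norm] at hpf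
  have h1 : ‖(∫ x, g x * f' (F n x) ∂μ) - ∫ x, g x * p (F n x) ∂μ‖ ≤
      (∫ x, ‖g x‖ ∂μ) * ‖f' - p‖ := by
    rw [← integral_sub (hint f' n) (hint p n), ← integral_mul_const]
    refine norm_integral_le_of_norm_le (hg.norm.mul_const _) (Eventually.of_forall fun x => ?_)
    rw [← mul_sub, norm_mul]
    exact mul_le_mul_of_nonneg_left ((f' - p).norm_coe_le_norm _) (norm_nonneg _)
  have h2 : ‖(c * ∫ y, p y ∂ν) - c * ∫ y, f' y ∂ν‖ ≤ ‖c‖ * ‖f' - p‖ := by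
    rw [← mul_sub, norm_mul, norm_sub_rev, ← integral_sub (hintν f') (hintν p)]
    refine mul_le_mul_of_nonneg_left ?_ (norm_nonneg _)
    refine (norm_integral_le_of_norm_le_const (C := ‖f' - p‖)
      (Eventually.of_forall fun x => (f' - p).norm_coe_le_norm _)).trans ?_
    simp
  have h3 := hN n hn
  rw [dist_eq_norm] at h3 ⊢
  have h4 : C * ‖f' - p‖ < ε / 2 := by
    calc C * ‖f' - p‖ < C * (ε / (2 * C)) := by gcongr
      _ = ε / 2 := by field_simp
  have h5 : (∫ x, ‖g x‖ ∂μ) * ‖f' - p‖ + ‖c‖ * ‖f' - p‖ ≤ C * ‖f' - p‖ := by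
    rw [hC]; nlinarith [norm_nonneg (f' - p)]
  calc ‖(∫ x, g x * f' (F n x) ∂μ) - c * ∫ y, f' y ∂ν‖
      = ‖((∫ x, g x * f' (F n x) ∂μ) - ∫ x, g x * p (F n x) ∂μ) +
          ((∫ x, g x * p (F n x) ∂μ) - c * ∫ y, p y ∂ν) +
          ((c * ∫ y, p y ∂ν) - c * ∫ y, f' y ∂ν)‖ := by congr 1; ring
    _ ≤ _ := norm_add₃_le
    _ < ε := by linarith

/-! ### Asymptotic relations -/

theorem tendsto_zero_iff_eventually_eq {u : ℕ → ℤ} :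
    Tendsto u atTop (𝓝 0) ↔ ∀ᶠ n in atTop, u n = 0 := by
  rw [nhds_discrete, tendsto_pure]

theorem tendsto_abs_zero_iff_eventually_eq {u : ℕ → ℤ} :
    Tendsto (fun n => |u n|) atTop (𝓝 0) ↔ ∀ᶠ n in atTop, u n = 0 := by
  simp only [tendsto_zero_iff_eventually_eq, abs_eq_zero]

/-- The asymptotic relations of `φ`, as a subgroup of `ℤ ^ ℓ`. -/
def asymptoticRelationGroup {ℓ : ℕ} (φ : Fin ℓ → ℕ → ℤ) : AddSubgroup (Fin ℓ → ℤ) where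
  carrier := asymptoticRelations φ
  zero_mem' := by simp [asymptoticRelations]
  add_mem' := by
    intro a b ha hb
    have h := Tendsto.add (show Tendsto _ _ _ from ha) hb
    simpa [asymptoticRelations, add_mul, Finset.sum_add_distrib] using h
  neg_mem' := by
    intro a ha
    have h := Tendsto.neg (show Tendsto _ _ _ from ha)
    simpa [asymptoticRelations] using h

theorem mem_asymptoticRelationGroup {ℓ : ℕ} {φ : Fin ℓ → ℕ → ℤ} {a : Fin ℓ → ℤ} :
    a ∈ asymptoticRelationGroup φ ↔ ∀ᶠ n in atTop, ∑ j, a j * φ j n = 0 :=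
  tendsto_zero_iff_eventually_eq

theorem Adequate.tendsto_of_notMem {ℓ : ℕ} {φ : Fin ℓ → ℕ → ℤ} (hφ : Adequate φ) {a : Fin ℓ → ℤ}
    (ha : a ∉ asymptoticRelationGroup φ) :
    Tendsto (fun n => |∑ j, a j * φ j n|) atTop atTop :=
  (hφ.2 a).resolve_left fun h =>
    ha (mem_asymptoticRelationGroup.mpr (tendsto_abs_zero_iff_eventually_eq.mp h))

/-! ### Simultaneous approximation by multiples of a point -/

/-- The Riemann-Lebesgue lemma along a sequence of frequencies. -/
theorem tendsto_integral_mul_fourier {m : ℕ → ℤ} (hm : Tendsto (fun n => |m n|) atTop atTop)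
    (h : C(Torus, ℂ)) :
    Tendsto (fun n => ∫ y, h y * fourier (m n) y ∂AddCircle.haarAddCircle) atTop (𝓝 0) := by
  have hm' : Tendsto (fun n => - m n) atTop cofinite := by
    rw [tendsto_def]
    intro s hs
    have hs' : Set.Finite ((fun k : ℤ => |k|) '' sᶜ) := (mem_cofinite.mp hs).image _
    obtain ⟨B, hB⟩ := hs'.bddAbove
    filter_upwards [hm.eventually_gt_atTop B] with n hn
    by_contra hns
    have := hB ⟨_, hns, rfl⟩
    simp only [abs_neg] at this
    omega
  have h0 := (hasSum_sq_fourierCoeff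
    (ContinuousMap.toLp 2 AddCircle.haarAddCircle ℂ h)).summable.tendsto_cofinite_zero
  simp only [fourierCoeff_toLp] at h0
  rw [tendsto_zero_iff_norm_tendsto_zero]
  have h1 := (h0.comp hm').sqrt
  simp only [Function.comp_def, Real.sqrt_sq (norm_nonneg _), Real.sqrt_zero, fourierCoeff, neg_neg,
    smul_eq_mul, mul_comm] at h1
  exact h1

/-- The orbit points `(φ 1 n • y, …, φ ℓ n • y)`, with `y` distributed with density `h`, become
equidistributed in the annihilator of the asymptotic relations. -/
theorem Adequate.tendsto_integral_mul {ℓ : ℕ} {φ : Fin ℓ → ℕ → ℤ} (hφ : Adequate φ)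
    (h : C(Torus, ℂ)) {f : (Fin ℓ → Torus) → ℂ} (hf : Continuous f) :
    Tendsto (fun n => ∫ y, h y * f (fun j => φ j n • y) ∂AddCircle.haarAddCircle) atTop
      (𝓝 ((∫ y, h y ∂AddCircle.haarAddCircle) *
        ∫ z, f z ∂(haarAnnihilator (asymptoticRelationGroup φ)))) := by
  refine tendsto_integral_of_tendsto_mFourier (F := fun n y j => φ j n • y)
    (Integrable.of_bound h.continuous.aestronglyMeasurable ‖h‖
      (Eventually.of_forall fun x => h.norm_coe_le_norm _)) (fun n => ?_) _ (fun a => ?_) hf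
  · exact (continuous_pi fun j => continuous_zsmul _).measurable
  · simp only [mFourier_zsmul]
    by_cases ha : a ∈ asymptoticRelationGroup φ
    · rw [integral_mFourier_haarAnnihilator_of_mem ha, mul_one]
      refine tendsto_const_nhds.congr' ?_
      filter_upwards [mem_asymptoticRelationGroup.mp ha] with n hn
      simp [hn]
    · rw [integral_mFourier_haarAnnihilator_of_notMem ha, mul_zero]
      exact tendsto_integral_mul_fourier (hφ.tendsto_of_notMem ha) h

/-- A continuous bump function supported in the ball of radius `r` around `x`. -/
noncomputable def bump {X : Type*} [PseudoMetricSpace X] (x : X) (r : ℝ) : C(X, ℝ) :=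
  ⟨fun y => max 0 (r - dist y x), by fun_prop⟩

theorem bump_nonneg {X : Type*} [PseudoMetricSpace X] (x : X) (r : ℝ) (y : X) : 0 ≤ bump x r y :=
  le_max_left _ _

theorem bump_eq_zero {X : Type*} [PseudoMetricSpace X] {x y : X} {r : ℝ} (h : r ≤ dist y x) :
    bump x r y = 0 :=
  max_eq_left (by linarith)

theorem bump_self_pos {X : Type*} [PseudoMetricSpace X] (x : X) {r : ℝ} (h : 0 < r) :
    0 < bump x r x := by
  simp [bump, h]

/-- Kronecker's approximation theorem at a fixed starting point `x` and target `α`: both bump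
functions have positive integral, so the orbit points of the ball around `x` cannot all miss the
ball around `α` for infinitely many `n`. -/
theorem Adequate.eventually_exists_dist_lt {ℓ : ℕ} {φ : Fin ℓ → ℕ → ℤ} (hφ : Adequate φ) (x : Torus)
    (α : annihilator (asymptoticRelationGroup φ)) {δ ε : ℝ} (hδ : 0 < δ) (hε : 0 < ε) :
    ∀ᶠ n in atTop, ∃ y, dist y x < δ ∧ dist (fun j => φ j n • y) (α : Fin ℓ → Torus) < ε := by
  by_contra hcon
  rw [not_eventually] at hcon
  have hlim := hφ.tendsto_integral_mul
    ((⟨Complex.ofReal, Complex.continuous_ofReal⟩ : C(ℝ, ℂ)).comp (bump x δ))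
    (f := fun z => ((bump (α : Fin ℓ → Torus) ε z : ℝ) : ℂ))
    (Complex.continuous_ofReal.comp (bump _ _).continuous)
  rw [integral_haarAnnihilator _ (f := fun z => ((bump (α : Fin ℓ → Torus) ε z : ℝ) : ℂ))
    (Complex.continuous_ofReal.comp (bump _ _).continuous)] at hlim
  simp only [ContinuousMap.comp_apply, ContinuousMap.coe_mk, integral_complex_ofReal] at hlim
  have hpos1 : 0 < ∫ y, bump x δ y ∂(AddCircle.haarAddCircle : Measure Torus) :=
    (bump x δ).continuous.integral_pos_of_hasCompactSupport_nonneg_nonzero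
      (HasCompactSupport.of_compactSpace _) (bump_nonneg x δ) (bump_self_pos x hδ).ne'
  have hpos2 : 0 < ∫ z : annihilator (asymptoticRelationGroup φ),
      bump (α : Fin ℓ → Torus) ε z ∂(annihilatorHaar _) :=
    ((bump _ _).continuous.comp continuous_subtype_val).integral_pos_of_hasCompactSupport_nonneg_nonzero
      (HasCompactSupport.of_compactSpace _) (fun z => bump_nonneg _ _ _) (bump_self_pos _ hε).ne'
  have hne := hlim.eventually_ne (by
    rw [← Complex.ofReal_mul, Ne, Complex.ofReal_eq_zero]
    exact (mul_pos hpos1 hpos2).ne')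
  obtain ⟨n, hn, hn'⟩ := (hcon.and_eventually hne).exists
  refine hn' ?_
  push Not at hn
  refine integral_eq_zero_of_ae (Eventually.of_forall fun y => ?_)
  by_cases hy : dist y x < δ
  · simp [bump_eq_zero (hn y hy)]
  · simp [bump_eq_zero (not_lt.mp hy)]

/-- Kronecker's approximation theorem for adequate sequences, uniform in the starting point `x` and
in the target `α`, by compactness. -/
theorem Adequate.eventually_forall_exists_dist_lt {ℓ : ℕ} {φ : Fin ℓ → ℕ → ℤ} (hφ : Adequate φ)
    {δ ε : ℝ} (hδ : 0 < δ) (hε : 0 < ε) :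
    ∀ᶠ n in atTop, ∀ (x : Torus) (α : annihilator (asymptoticRelationGroup φ)),
      ∃ y, dist y x < δ ∧ dist (fun j => φ j n • y) (α : Fin ℓ → Torus) < ε := by
  have hδ2 := half_pos hδ
  have hε2 := half_pos hε
  obtain ⟨t, ht⟩ := CompactSpace.elim_nhds_subcover
    (fun p : Torus × annihilator (asymptoticRelationGroup φ) =>
      Metric.ball p.1 (δ / 2) ×ˢ Metric.ball p.2 (ε / 2))
    (fun p => prod_mem_nhds (Metric.ball_mem_nhds _ hδ2) (Metric.ball_mem_nhds _ hε2))
  have hall : ∀ᶠ n in atTop, ∀ p ∈ t, ∃ y, dist y p.1 < δ / 2 ∧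
      dist (fun j => φ j n • y) (p.2 : Fin ℓ → Torus) < ε / 2 :=
    (eventually_all_finset t).mpr fun p _ => hφ.eventually_exists_dist_lt p.1 p.2 hδ2 hε2
  filter_upwards [hall] with n hn x α
  have hx : (x, α) ∈ ⋃ p ∈ t, Metric.ball p.1 (δ / 2) ×ˢ Metric.ball p.2 (ε / 2) := by
    rw [ht]; trivial
  simp only [Set.mem_iUnion, Set.mem_prod, Metric.mem_ball] at hx
  obtain ⟨p, hp, hpx, hpα⟩ := hx
  obtain ⟨y, hy1, hy2⟩ := hn p hp
  refine ⟨y, ?_, ?_⟩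
  · linarith [dist_triangle y p.1 x, dist_comm x p.1]
  · rw [Subtype.dist_eq] at hpα
    linarith [dist_triangle (fun j => φ j n • y) (p.2 : Fin ℓ → Torus) α,
      dist_comm (α : Fin ℓ → Torus) p.2]

/-! ### A point whose multiples track prescribed points of the annihilator -/

theorem annihilator_le_annihilator {ℓ : ℕ} {A G : AddSubgroup (Fin ℓ → ℤ)} (h : A ≤ G) :
    annihilator G ≤ annihilator A :=
  fun _ hα a ha => hα a (h ha)

/-- The approximating point can be chosen measurably: take the first suitable term of a dense
sequence. -/
theorem exists_measurable_dist_lt {ℓ : ℕ} {m : Fin ℓ → ℤ} {K : AddSubgroup (Fin ℓ → Torus)}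
    {δ ε : ℝ} (h : ∀ (x : Torus) (α : K),
      ∃ y, dist y x < δ ∧ dist (fun j => m j • y) (α : Fin ℓ → Torus) < ε) :
    ∃ S : Torus × K → Torus, Measurable S ∧
      ∀ p, dist (S p) p.1 < δ ∧ dist (fun j => m j • S p) (p.2 : Fin ℓ → Torus) < ε := by
  classical
  have hm : Continuous fun (y : Torus) (j : Fin ℓ) => m j • y :=
    continuous_pi fun j => continuous_zsmul _
  let q := TopologicalSpace.denseSeq Torus
  have hex : ∀ p : Torus × K, ∃ i,
      dist (q i) p.1 < δ ∧ dist (fun j => m j • q i) (p.2 : Fin ℓ → Torus) < ε := by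
    intro p
    have hopen : IsOpen {y | dist y p.1 < δ ∧ dist (fun j => m j • y) (p.2 : Fin ℓ → Torus) < ε} :=
      (isOpen_lt (continuous_id.dist continuous_const) continuous_const).inter
        (isOpen_lt (hm.dist continuous_const) continuous_const)
    obtain ⟨y, hy, i, rfl⟩ := (TopologicalSpace.denseRange_denseSeq Torus).inter_open_nonempty _
      hopen (h p.1 p.2)
    exact ⟨i, hy⟩
  refine ⟨fun p => q (Nat.find (hex p)), ?_, fun p => Nat.find_spec (hex p)⟩
  refine Measurable.find (f := fun i (_ : Torus × K) => q i) (fun i => measurable_const)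
    (fun i => ?_) hex
  refine IsOpen.measurableSet (IsOpen.inter ?_ ?_)
  · exact isOpen_lt (continuous_const.dist continuous_fst) continuous_const
  · exact isOpen_lt (continuous_const.dist (continuous_subtype_val.comp continuous_snd))
      continuous_const

/-- The times `n k` and the step sizes `δ k`. The bound on `|φ j (n k)| * δ (k + 1)` says that the
moves made after time `n k` do not spoil the approximation obtained at that time. -/
theorem Adequate.exists_approximation_times {ℓ : ℕ} {φ : Fin ℓ → ℕ → ℤ} (hφ : Adequate φ) :
    ∃ (n : ℕ → ℕ) (δ : ℕ → ℝ), StrictMono n ∧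
      (∀ k, 0 ≤ δ k ∧ δ (k + 1) ≤ δ k / 2 ∧ ∀ j, |(φ j (n k) : ℝ)| * δ (k + 1) ≤ (1 / 2) ^ k) ∧
      ∀ k (x : Torus) (α : annihilator (asymptoticRelationGroup φ)), ∃ y, dist y x < δ k ∧
        dist (fun j => φ j (n k) • y) (α : Fin ℓ → Torus) < (1 / 2) ^ k := by
  have hstep : ∀ (k : ℕ) (p : ℕ × {d : ℝ // 0 < d}), ∃ q : ℕ × {d : ℝ // 0 < d}, p.1 < q.1 ∧
      (q.2 : ℝ) ≤ p.2 / 2 ∧ (∀ j, |(φ j p.1 : ℝ)| * q.2 ≤ (1 / 2) ^ k) ∧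
      ∀ (x : Torus) (α : annihilator (asymptoticRelationGroup φ)), ∃ y, dist y x < q.2 ∧
        dist (fun j => φ j q.1 • y) (α : Fin ℓ → Torus) < (1 / 2) ^ (k + 1) := by
    intro k p
    have hp := p.2.2
    -- The summand `1` keeps `B` positive.
    set B : ℝ := 1 + ∑ j, |(φ j p.1 : ℝ)| with hB
    have hBj : ∀ j, |(φ j p.1 : ℝ)| ≤ B := fun j => by
      have := Finset.single_le_sum (f := fun j => |(φ j p.1 : ℝ)|) (fun i _ => abs_nonneg _)
        (Finset.mem_univ j)
      linarith
    have hB0 : 0 < B := by positivity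
    let d : {d : ℝ // 0 < d} := ⟨min (p.2 / 2) ((1 / 2) ^ k / B), by positivity⟩
    obtain ⟨m, hm, hpm⟩ := ((hφ.eventually_forall_exists_dist_lt d.2
      (ε := (1 / 2) ^ (k + 1)) (by positivity)).and (eventually_gt_atTop p.1)).exists
    refine ⟨(m, d), hpm, min_le_left _ _, fun j => ?_, hm⟩
    calc |(φ j p.1 : ℝ)| * d ≤ B * ((1 / 2) ^ k / B) :=
          mul_le_mul (hBj j) (min_le_right _ _) d.2.le hB0.le
      _ = (1 / 2) ^ k := by field_simp
  choose step hlt hhalf hmul happ using hstep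
  obtain ⟨n₀, hn₀⟩ := (hφ.eventually_forall_exists_dist_lt one_pos one_pos).exists
  let s : ℕ → ℕ × {d : ℝ // 0 < d} := fun k => Nat.rec (n₀, ⟨1, one_pos⟩) step k
  refine ⟨fun k => (s k).1, fun k => (s k).2, strictMono_nat_of_lt_succ fun k => hlt k (s k),
    fun k => ⟨(s k).2.2.le, hhalf k (s k), hmul k (s k)⟩, fun k => ?_⟩
  cases k with
  | zero => simpa [s] using hn₀
  | succ k => exact happ k (s k)

/-- Along suitable times `n k`, every sequence `ω` in the annihilator of `G` is followed by the
multiples of a single point `X ω`, which depends measurably on `ω`. -/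
theorem Adequate.exists_tracking {ℓ : ℕ} {φ : Fin ℓ → ℕ → ℤ} (hφ : Adequate φ)
    {G : AddSubgroup (Fin ℓ → ℤ)} (hG : asymptoticRelationGroup φ ≤ G) :
    ∃ n : ℕ → ℕ, StrictMono n ∧ ∃ X : (ℕ → annihilator G) → Torus, Measurable X ∧
      ∀ k ω, dist (fun j => φ j (n k) • X ω) (ω k : Fin ℓ → Torus) ≤ 3 * (1 / 2) ^ k := by
  obtain ⟨n, δ, hn, hδ, happ⟩ := hφ.exists_approximation_times
  have hS : ∀ k, ∃ S : Torus × annihilator G → Torus, Measurable S ∧ ∀ p, dist (S p) p.1 < δ k ∧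
      dist (fun j => φ j (n k) • S p) (p.2 : Fin ℓ → Torus) < (1 / 2) ^ k := fun k =>
    exists_measurable_dist_lt fun x α => happ k x ⟨α, annihilator_le_annihilator hG α.2⟩
  choose S hSm hS1 hS2 using hS
  let Z : ℕ → (ℕ → annihilator G) → Torus := fun k ω => Nat.rec 0 (fun i z => S i (z, ω i)) k
  have hZm : ∀ k, Measurable (Z k) := by
    intro k
    induction k with
    | zero => exact measurable_const
    | succ k ih => exact (hSm k).comp (ih.prodMk (measurable_pi_apply k))
  have hδgeom : ∀ k i, δ (k + i) ≤ δ k * (1 / 2) ^ i := by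
    intro k i
    induction i with
    | zero => simp
    | succ i ih =>
      have := (hδ (k + i)).2.1
      rw [← add_assoc, pow_succ]
      linarith
  have hZd : ∀ ω k i, dist (Z (k + i) ω) (Z (k + (i + 1)) ω) ≤ δ k * (1 / 2) ^ i := by
    intro ω k i
    rw [dist_comm]
    exact (hS1 (k + i) (Z (k + i) ω, ω (k + i))).le.trans (hδgeom k i)
  have hlim : ∀ ω, ∃ x, Tendsto (fun k => Z k ω) atTop (𝓝 x) := by
    intro ω
    refine cauchySeq_tendsto_of_complete (cauchySeq_of_le_geometric (1 / 2) (δ 0) (by norm_num)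
      fun i => ?_)
    simpa using hZd ω 0 i
  choose X hX using hlim
  refine ⟨n, hn, X, measurable_of_tendsto_metrizable hZm (tendsto_pi_nhds.mpr hX), fun k ω => ?_⟩
  have hXZ : dist (Z (k + 1) ω) (X ω) ≤ 2 * δ (k + 1) := by
    have h := dist_le_of_le_geometric_of_tendsto₀ (1 / 2) (δ (k + 1)) (by norm_num)
      (hZd ω (k + 1)) ((hX ω).comp (tendsto_atTop_mono (fun i => Nat.le_add_left i (k + 1))
        tendsto_id))
    rw [add_zero] at h
    refine h.trans_eq ?_
    rw [div_eq_iff (by norm_num)]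
    ring
  have h1 : dist (fun j => φ j (n k) • X ω) (fun j => φ j (n k) • Z (k + 1) ω) ≤
      2 * (1 / 2) ^ k := by
    refine (dist_pi_le_iff (by positivity)).mpr fun j => ?_
    rw [dist_eq_norm, ← zsmul_sub]
    refine (norm_zsmul_le _ _).trans ?_
    rw [← dist_eq_norm, dist_comm, Int.norm_eq_abs]
    calc |(φ j (n k) : ℝ)| * dist (Z (k + 1) ω) (X ω)
        ≤ |(φ j (n k) : ℝ)| * (2 * δ (k + 1)) := by gcongr
      _ = 2 * (|(φ j (n k) : ℝ)| * δ (k + 1)) := by ring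
      _ ≤ 2 * (1 / 2) ^ k := by linarith [(hδ k).2.2 j]
  have h2 := hS2 k (Z k ω, ω k)
  calc dist (fun j => φ j (n k) • X ω) (ω k : Fin ℓ → Torus)
      ≤ dist (fun j => φ j (n k) • X ω) (fun j => φ j (n k) • Z (k + 1) ω) +
        dist (fun j => φ j (n k) • Z (k + 1) ω) (ω k : Fin ℓ → Torus) := dist_triangle _ _ _
    _ ≤ 2 * (1 / 2) ^ k + (1 / 2) ^ k := add_le_add h1 h2.le
    _ = 3 * (1 / 2) ^ k := by ring

/-! ### Independent Haar-distributed targets -/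

/-- The law of a sequence of independent Haar-distributed points of the annihilator of `G`. -/
noncomputable abbrev iidHaar {ℓ : ℕ} (G : AddSubgroup (Fin ℓ → ℤ)) :
    Measure (ℕ → annihilator G) :=
  Measure.infinitePi fun _ => annihilatorHaar G

theorem integral_mFourier_iidHaar {ℓ : ℕ} {G : AddSubgroup (Fin ℓ → ℤ)} {a : Fin ℓ → ℤ}
    (ha : a ∉ G) (k : ℕ) :
    ∫ ω : ℕ → annihilator G, UnitAddTorus.mFourier a (ω k : Fin ℓ → Torus) ∂(iidHaar G) = 0 := by
  rw [← integral_mFourier_annihilatorHaar_of_notMem ha,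
    ← (measurePreserving_eval_infinitePi (fun _ : ℕ => annihilatorHaar G) k).map_eq,
    integral_map (measurable_pi_apply k).aemeasurable]
  · exact ((UnitAddTorus.mFourier a).continuous.comp
      continuous_subtype_val).aestronglyMeasurable

theorem measurable_mFourier_apply {ℓ : ℕ} {G : AddSubgroup (Fin ℓ → ℤ)} (a : Fin ℓ → ℤ) (k : ℕ) :
    Measurable fun ω : ℕ → annihilator G => UnitAddTorus.mFourier a (ω k : Fin ℓ → Torus) :=
  (UnitAddTorus.mFourier a).continuous.measurable.comp
    (measurable_subtype_coe.comp (measurable_pi_apply k))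

theorem integral_mFourier_mul_iidHaar {ℓ : ℕ} {G : AddSubgroup (Fin ℓ → ℤ)} {a b : Fin ℓ → ℤ}
    (ha : a ∉ G) {i k : ℕ} (hik : i ≠ k) :
    ∫ ω : ℕ → annihilator G, UnitAddTorus.mFourier a (ω i : Fin ℓ → Torus) *
      UnitAddTorus.mFourier b (ω k : Fin ℓ → Torus) ∂(iidHaar G) = 0 := by
  have hm : ∀ c : Fin ℓ → ℤ, Measurable fun z : annihilator G =>
      UnitAddTorus.mFourier c (z : Fin ℓ → Torus) := fun c =>
    (UnitAddTorus.mFourier c).continuous.measurable.comp measurable_subtype_coe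
  have hind : ProbabilityTheory.IndepFun (fun ω : ℕ → annihilator G => ω i) (fun ω => ω k)
      (iidHaar G) :=
    (ProbabilityTheory.iIndepFun_infinitePi (P := fun _ : ℕ => annihilatorHaar G)
      (X := fun _ z => z) fun _ => measurable_id).indepFun hik
  have h := (hind.comp (hm a) (hm b)).integral_mul_eq_mul_integral
    (measurable_mFourier_apply a i).aestronglyMeasurable
    (measurable_mFourier_apply b k).aestronglyMeasurable
  refine h.trans ?_
  rw [show ∫ ω : ℕ → annihilator G, ((fun z : annihilator G =>
      UnitAddTorus.mFourier a (z : Fin ℓ → Torus)) ∘ fun ω => ω i) ω ∂(iidHaar G) = 0 from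
    integral_mFourier_iidHaar ha i, zero_mul]

/-- A nontrivial character, evaluated at independent points, gives an orthonormal sequence, so it
averages out against every square integrable weight. -/
theorem tendsto_integral_mul_mFourier_iidHaar {ℓ : ℕ} {G : AddSubgroup (Fin ℓ → ℤ)}
    {a : Fin ℓ → ℤ} (ha : a ∉ G) {g : (ℕ → annihilator G) → ℂ} (hg : MemLp g 2 (iidHaar G)) :
    Tendsto (fun k => ∫ ω, g ω * UnitAddTorus.mFourier a (ω k : Fin ℓ → Torus) ∂(iidHaar G))
      atTop (𝓝 0) := by
  have hmem : ∀ k, MemLp (fun ω : ℕ → annihilator G =>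
      UnitAddTorus.mFourier (-a) (ω k : Fin ℓ → Torus)) 2 (iidHaar G) := fun k =>
    MemLp.of_bound (measurable_mFourier_apply _ k).aestronglyMeasurable 1
      (Eventually.of_forall fun ω => (norm_mFourier_apply _ _).le)
  have hinner : ∀ k (f : (ℕ → annihilator G) → ℂ) (hf : MemLp f 2 (iidHaar G)),
      inner ℂ ((hmem k).toLp _) (hf.toLp f) =
        ∫ ω, f ω * UnitAddTorus.mFourier a (ω k : Fin ℓ → Torus) ∂(iidHaar G) := by
    intro k f hf
    rw [L2.inner_def]
    refine integral_congr_ae ?_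
    filter_upwards [(hmem k).coeFn_toLp, hf.coeFn_toLp] with ω h1 h2
    rw [h1, h2, RCLike.inner_apply, UnitAddTorus.mFourier_neg, RingHomCompTriple.comp_apply]
    rfl
  have horth : Orthonormal ℂ fun k => (hmem k).toLp _ := by
    rw [orthonormal_iff_ite]
    intro i k
    rw [hinner i _ (hmem k)]
    split_ifs with hik
    · subst hik
      have : ∀ ω : ℕ → annihilator G, UnitAddTorus.mFourier (-a) (ω i : Fin ℓ → Torus) *
          UnitAddTorus.mFourier a (ω i : Fin ℓ → Torus) = 1 := fun ω => by
        rw [← UnitAddTorus.mFourier_add, neg_add_cancel, UnitAddTorus.mFourier_zero]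
        rfl
      simp [this]
    · exact integral_mFourier_mul_iidHaar (by simpa using ha) (Ne.symm hik)
  have h := horth.tendsto_inner_cofinite (hg.toLp g)
  rw [Nat.cofinite_eq_atTop] at h
  simpa only [hinner] using h

/-- Replacing `F k` by a uniformly close `F' k` does not change the limit of weighted integrals of a
continuous function. -/
theorem tendsto_integral_mul_sub {ℓ : ℕ} {Ω : Type*} [MeasurableSpace Ω] {μ : Measure Ω}
    {g : Ω → ℂ} (hg : Integrable g μ) {F F' : ℕ → Ω → (Fin ℓ → Torus)}
    (hF : ∀ k, Measurable (F k)) (hF' : ∀ k, Measurable (F' k)) {η : ℕ → ℝ}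
    (hη : Tendsto η atTop (𝓝 0)) (hd : ∀ k ω, dist (F k ω) (F' k ω) ≤ η k)
    (f : C((Fin ℓ → Torus), ℂ)) :
    Tendsto (fun k => ∫ ω, g ω * (f (F k ω) - f (F' k ω)) ∂μ) atTop (𝓝 0) := by
  rw [← integral_zero Ω ℂ (μ := μ)]
  refine tendsto_integral_of_dominated_convergence (fun ω => ‖g ω‖ * (‖f‖ + ‖f‖)) (fun k => ?_)
    (hg.norm.mul_const _) (fun k => Eventually.of_forall fun ω => ?_)
    (Eventually.of_forall fun ω => ?_)
  · exact hg.aestronglyMeasurable.mul ((f.continuous.measurable.comp (hF k)).sub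
      (f.continuous.measurable.comp (hF' k))).aestronglyMeasurable
  · rw [norm_mul]
    refine mul_le_mul_of_nonneg_left ?_ (norm_nonneg _)
    exact (norm_sub_le _ _).trans (add_le_add (f.norm_coe_le_norm _) (f.norm_coe_le_norm _))
  · have huc := CompactSpace.uniformContinuous_of_continuous f.continuous
    have hd0 : Tendsto (fun k => dist (F k ω) (F' k ω)) atTop (𝓝 0) :=
      squeeze_zero (fun _ => dist_nonneg) (fun k => hd k ω) hη
    have h' : Tendsto (fun k => f (F k ω) - f (F' k ω)) atTop (𝓝 0) := by
      refine Metric.tendsto_nhds.mpr fun ε hε => ?_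
      obtain ⟨δ, hδ, h⟩ := Metric.uniformContinuous_iff.mp huc ε hε
      filter_upwards [hd0.eventually_lt_const hδ] with k hk
      rw [dist_zero_right, ← dist_eq_norm]
      exact h hk
    simpa using h'.const_mul (g ω)

/-- The law `σ` of the tracking point of independent Haar-distributed targets. The orbit points at
time `n k` are uniformly close to the `k`-th target, and the targets decorrelate from every fixed
event, which gives convergence also on each measurable set `E`. -/
theorem Adequate.exists_measure_tendsto {ℓ : ℕ} {φ : Fin ℓ → ℕ → ℤ} (hφ : Adequate φ)
    {G : AddSubgroup (Fin ℓ → ℤ)} (hG : asymptoticRelationGroup φ ≤ G) :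
    ∃ (σ : Measure Torus) (_ : IsProbabilityMeasure σ) (n : ℕ → ℕ), StrictMono n ∧
      ∀ f : (Fin ℓ → Torus) → ℂ, Continuous f → ∀ E : Set Torus, MeasurableSet E →
        Tendsto
          (fun k => ∫ x, E.indicator (fun _ => (1 : ℂ)) x * f (fun j => φ j (n k) • x) ∂σ)
          atTop (𝓝 ((σ.real E : ℂ) * ∫ y, f y ∂(haarAnnihilator G))) := by
  obtain ⟨n, hn, X, hXm, hX⟩ := hφ.exists_tracking hG
  have hσ : IsProbabilityMeasure ((iidHaar G).map X) :=
    Measure.isProbabilityMeasure_map hXm.aemeasurable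
  refine ⟨(iidHaar G).map X, hσ, n, hn, fun f hf E hE => ?_⟩
  have hind : Measurable (E.indicator fun _ : Torus => (1 : ℂ)) := measurable_const.indicator hE
  have hbound : ∀ x, ‖E.indicator (fun _ : Torus => (1 : ℂ)) x‖ ≤ 1 := fun x =>
    (norm_indicator_le_norm_self _ _).trans norm_one.le
  have hφm : ∀ k, Continuous fun (x : Torus) (j : Fin ℓ) => φ j (n k) • x := fun k =>
    continuous_pi fun j => continuous_zsmul _
  have hg : MemLp (fun ω => E.indicator (fun _ : Torus => (1 : ℂ)) (X ω)) 2 (iidHaar G) :=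
    MemLp.of_bound (hind.comp hXm).aestronglyMeasurable 1 (Eventually.of_forall fun ω => hbound _)
  have hgi := hg.integrable one_le_two
  have hmean : ((((iidHaar G).map X).real E : ℝ) : ℂ) =
      ∫ ω, E.indicator (fun _ : Torus => (1 : ℂ)) (X ω) ∂(iidHaar G) := by
    rw [← integral_map hXm.aemeasurable hind.aestronglyMeasurable, integral_indicator_const _ hE]
    simp
  have hη : Tendsto (fun k : ℕ => 3 * (1 / 2 : ℝ) ^ k) atTop (𝓝 0) := by
    simpa using (tendsto_pow_atTop_nhds_zero_of_lt_one (r := (1 / 2 : ℝ)) (by norm_num)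
      (by norm_num)).const_mul 3
  have hFm : ∀ k, Measurable fun ω (j : Fin ℓ) => φ j (n k) • X ω := fun k =>
    (hφm k).measurable.comp hXm
  have hωm : ∀ k, Measurable fun ω : ℕ → annihilator G => (ω k : Fin ℓ → Torus) := fun k =>
    measurable_subtype_coe.comp (measurable_pi_apply k)
  have key := tendsto_integral_of_tendsto_mFourier (ν := haarAnnihilator G) hgi hFm
    (((iidHaar G).map X).real E : ℂ) (fun a => ?_) hf
  · refine key.congr fun k => ?_
    rw [integral_map hXm.aemeasurable]
    exact (hind.mul (hf.comp (hφm k)).measurable).aestronglyMeasurable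
  · have hdiff := tendsto_integral_mul_sub hgi hFm hωm hη hX (UnitAddTorus.mFourier a)
    have hint : ∀ (Y : (ℕ → annihilator G) → (Fin ℓ → Torus)), Measurable Y → Integrable (fun ω =>
        E.indicator (fun _ : Torus => (1 : ℂ)) (X ω) * UnitAddTorus.mFourier a (Y ω))
          (iidHaar G) := fun Y hY =>
      hgi.mul_bdd (c := 1) ((UnitAddTorus.mFourier a).continuous.measurable.comp
        hY).aestronglyMeasurable (Eventually.of_forall fun ω => (norm_mFourier_apply _ _).le)
    have hlim : Tendsto (fun k => ∫ ω, E.indicator (fun _ : Torus => (1 : ℂ)) (X ω) *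
        UnitAddTorus.mFourier a (ω k : Fin ℓ → Torus) ∂(iidHaar G)) atTop
        (𝓝 ((((iidHaar G).map X).real E : ℂ) *
          ∫ y, UnitAddTorus.mFourier a y ∂(haarAnnihilator G))) := by
      by_cases ha : a ∈ G
      · rw [integral_mFourier_haarAnnihilator_of_mem ha, mul_one, hmean]
        simp [mFourier_eq_one_of_mem ha]
      · rw [integral_mFourier_haarAnnihilator_of_notMem ha, mul_zero]
        exact tendsto_integral_mul_mFourier_iidHaar ha hg
    have hsum := hdiff.add hlim
    rw [zero_add] at hsum
    refine hsum.congr fun k => ?_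
    rw [← integral_add _ (hint _ (hωm k))]
    · refine integral_congr_ae (Eventually.of_forall fun ω => ?_)
      simp only
      ring
    · simp only [mul_sub]
      exact (hint _ (hFm k)).sub (hint _ (hωm k))

/-! ### Multiplication operators and rigidity -/

section Multiplication

variable {Y : Type*} [MeasurableSpace Y] {μ : Measure Y}

theorem memLp_character_mul {T : Y → Torus} (hT : Measurable T) (m : ℤ) (f : Lp ℂ 2 μ) :
    MemLp (fun y => fourier m (T y) * f y) 2 μ :=
  (Lp.memLp f).of_le
    (((fourier m).continuous.measurable.comp hT).aestronglyMeasurable.mul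
      (Lp.aestronglyMeasurable f))
    (Eventually.of_forall fun y => by
      rw [norm_mul, fourier_apply, Circle.norm_coe, one_mul])

theorem fourier_neg_mul_self (m : ℤ) (x : Torus) : fourier (-m) x * fourier m x = 1 := by
  rw [← fourier_add, neg_add_cancel, fourier_zero]

/-- Multiplication by `e ^ (2 π i m T)`, as a unitary operator on `L²`. -/
noncomputable def mulCharacter (μ : Measure Y) {T : Y → Torus} (hT : Measurable T) (m : ℤ) :
    Lp ℂ 2 μ ≃ₗᵢ[ℂ] Lp ℂ 2 μ where
  toFun f := (memLp_character_mul hT m f).toLp _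
  invFun f := (memLp_character_mul hT (-m) f).toLp _
  map_add' f g := by
    ext1
    filter_upwards [(memLp_character_mul hT m (f + g)).coeFn_toLp, Lp.coeFn_add f g,
      (memLp_character_mul hT m f).coeFn_toLp, (memLp_character_mul hT m g).coeFn_toLp,
      Lp.coeFn_add ((memLp_character_mul hT m f).toLp _) ((memLp_character_mul hT m g).toLp _)]
      with y h1 h2 h3 h4 h5
    rw [h1, h2, h5, Pi.add_apply, Pi.add_apply, h3, h4, mul_add]
  map_smul' c f := by
    ext1
    filter_upwards [(memLp_character_mul hT m (c • f)).coeFn_toLp, Lp.coeFn_smul c f,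
      (memLp_character_mul hT m f).coeFn_toLp,
      Lp.coeFn_smul c ((memLp_character_mul hT m f).toLp _)] with y h1 h2 h3 h4
    rw [h1, h2, RingHom.id_apply, h4, Pi.smul_apply, Pi.smul_apply, h3, smul_eq_mul, smul_eq_mul,
      mul_left_comm]
  left_inv f := by
    ext1
    filter_upwards [(memLp_character_mul hT (-m) ((memLp_character_mul hT m f).toLp _)).coeFn_toLp,
      (memLp_character_mul hT m f).coeFn_toLp] with y h1 h2
    rw [h1, h2, ← mul_assoc, fourier_neg_mul_self, one_mul]
  right_inv f := by
    ext1
    filter_upwards [(memLp_character_mul hT m ((memLp_character_mul hT (-m) f).toLp _)).coeFn_toLp,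
      (memLp_character_mul hT (-m) f).coeFn_toLp] with y h1 h2
    rw [h1, h2, ← mul_assoc, mul_comm (fourier m (T y)), fourier_neg_mul_self, one_mul]
  norm_map' f := by
    refine (Lp.norm_toLp _ (memLp_character_mul hT m f)).trans ?_
    rw [Lp.norm_def]
    congr 1
    exact eLpNorm_congr_norm_ae (Eventually.of_forall fun y => by
      rw [norm_mul, fourier_apply, Circle.norm_coe, one_mul])

theorem coeFn_mulCharacter {T : Y → Torus} (hT : Measurable T) (m : ℤ) (f : Lp ℂ 2 μ) :
    mulCharacter μ hT m f =ᵐ[μ] fun y => fourier m (T y) * f y :=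
  (memLp_character_mul hT m f).coeFn_toLp

theorem mulCharacter_one_zpow {T : Y → Torus} (hT : Measurable T) (m : ℤ) :
    mulCharacter μ hT 1 ^ m = mulCharacter μ hT m := by
  let F : Multiplicative ℤ →* (Lp ℂ 2 μ ≃ₗᵢ[ℂ] Lp ℂ 2 μ) :=
    { toFun := fun k => mulCharacter μ hT k.toAdd
      map_one' := by
        ext1 f
        ext1
        filter_upwards [coeFn_mulCharacter (μ := μ) hT 0 f] with y h
        simpa using h
      map_mul' := fun k l => by
        ext1 f
        ext1
        filter_upwards [coeFn_mulCharacter hT (k * l).toAdd f,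
          coeFn_mulCharacter hT l.toAdd f,
          coeFn_mulCharacter hT k.toAdd (mulCharacter μ hT l.toAdd f)] with y h1 h2 h3
        rw [h1, toAdd_mul, fourier_add, mul_assoc, ← h2, ← h3]
        rfl }
  exact (MonoidHom.apply_mint _ F (Multiplicative.ofAdd m)).symm

/-- The vectors asymptotically fixed by a sequence of isometries form a closed set. -/
theorem isClosed_setOf_tendsto_norm_sub {E : Type*} [NormedAddCommGroup E] [InnerProductSpace ℂ E]
    (V : ℕ → E ≃ₗᵢ[ℂ] E) :
    IsClosed {f | Tendsto (fun k => ‖V k f - f‖) atTop (𝓝 0)} := by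
  refine isClosed_of_closure_subset fun f hf => ?_
  refine Metric.tendsto_nhds.mpr fun ε hε => ?_
  obtain ⟨g, hg, hfg⟩ := Metric.mem_closure_iff.mp hf (ε / 3) (by positivity)
  filter_upwards [(show Tendsto _ _ _ from hg).eventually_lt_const
    (show (0 : ℝ) < ε / 3 by positivity)] with k hk
  rw [dist_zero_right, norm_norm]
  rw [dist_eq_norm] at hfg
  calc ‖V k f - f‖ = ‖V k (f - g) + (V k g - g) + (g - f)‖ := by
        rw [map_sub]; congr 1; abel
    _ ≤ ‖V k (f - g)‖ + ‖V k g - g‖ + ‖g - f‖ := norm_add₃_le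
    _ < ε := by
      rw [LinearIsometryEquiv.norm_map, norm_sub_rev g f]
      linarith

/-- Powers of a multiplication operator converge strongly to the identity as soon as they do so,
in mean, on the constant function. -/
theorem tendsto_mulCharacter_zpow_iff [IsProbabilityMeasure μ] {T : Y → Torus} (hT : Measurable T)
    (s : ℕ → ℤ) :
    (∀ f : Lp ℂ 2 μ, Tendsto (fun k => ‖(mulCharacter μ hT 1 ^ s k) f - f‖) atTop (𝓝 0)) ↔
      Tendsto (fun k => ∫ y, fourier (s k) (T y) ∂μ) atTop (𝓝 1) := by
  set e : Lp ℂ 2 μ := Lp.const 2 μ (1 : ℂ) with he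
  have hinner : ∀ f : Lp ℂ 2 μ, inner ℂ e f = ∫ y, f y ∂μ := fun f => by
    rw [L2.inner_def]
    refine integral_congr_ae ?_
    filter_upwards [Lp.coeFn_const (p := 2) (μ := μ) (1 : ℂ)] with y h
    rw [he, h]
    simp
  have hVe : ∀ m : ℤ, (mulCharacter μ hT 1 ^ m) e =ᵐ[μ] fun y => fourier m (T y) := by
    intro m
    rw [mulCharacter_one_zpow]
    filter_upwards [coeFn_mulCharacter hT m e,
      Lp.coeFn_const (p := 2) (μ := μ) (1 : ℂ)] with y h1 h2
    rw [h1, he, h2]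
    simp
  have hV : ∀ m : ℤ, inner ℂ e ((mulCharacter μ hT 1 ^ m) e) = ∫ y, fourier m (T y) ∂μ :=
    fun m => (hinner _).trans (integral_congr_ae (hVe m))
  have hee : inner ℂ e e = (1 : ℂ) := by simpa using hV 0
  have hne : ‖e‖ ^ 2 = 1 := by
    rw [← inner_self_eq_norm_sq (𝕜 := ℂ), hee]; simp
  constructor
  · intro h
    rw [tendsto_iff_norm_sub_tendsto_zero]
    refine squeeze_zero (fun _ => norm_nonneg _) (fun k => ?_) (by simpa using (h e).const_mul ‖e‖)
    rw [← hV, ← hee, ← inner_sub_right]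
    exact norm_inner_le_norm _ _
  · intro h
    -- `‖V e - e‖² = 2 - 2 Re ⟪e, V e⟫` for a unitary `V` and the unit vector `e = 1`.
    have hsq : Tendsto (fun k => ‖(mulCharacter μ hT 1 ^ s k) e - e‖ ^ 2) atTop (𝓝 0) := by
      have h1 : Tendsto (fun k => 2 - 2 * (∫ y, fourier (s k) (T y) ∂μ).re) atTop
          (𝓝 (2 - 2 * (1 : ℂ).re)) :=
        (((Complex.continuous_re.tendsto _).comp h).const_mul 2).const_sub 2
      simp only [Complex.one_re, mul_one, sub_self] at h1
      refine h1.congr fun k => ?_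
      rw [norm_sub_rev, norm_sub_sq (𝕜 := ℂ), hV, LinearIsometryEquiv.norm_map, hne]
      simp only [RCLike.re_to_complex]
      ring
    have hconst : Tendsto (fun k => ‖(mulCharacter μ hT 1 ^ s k) e - e‖) atTop (𝓝 0) := by
      simpa [Real.sqrt_sq] using hsq.sqrt
    refine Lp.induction (by norm_num) _ ?_ ?_
      (isClosed_setOf_tendsto_norm_sub fun k => mulCharacter μ hT 1 ^ s k)
    · intro c S hS hμS
      refine squeeze_zero (fun _ => norm_nonneg _) (fun k => ?_)
        (by simpa using hconst.const_mul ‖c‖)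
      refine Lp.norm_le_mul_norm_of_ae_le_mul ?_
      set f : Lp ℂ 2 μ := ↑(Lp.simpleFunc.indicatorConst 2 hS hμS.ne c) with hf
      have hfe : f =ᵐ[μ] S.indicator fun _ => c := by
        rw [hf, Lp.simpleFunc.coe_indicatorConst]
        exact indicatorConstLp_coeFn
      have hVf := coeFn_mulCharacter hT (s k) f
      rw [← mulCharacter_one_zpow hT] at hVf
      filter_upwards [hfe, hVf, hVe (s k), Lp.coeFn_const (p := 2) (μ := μ) (1 : ℂ),
        Lp.coeFn_sub ((mulCharacter μ hT 1 ^ s k) f) f,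
        Lp.coeFn_sub ((mulCharacter μ hT 1 ^ s k) e) e]
        with y h1 h2 h3 h4 h5 h6
      rw [h5, h6, Pi.sub_apply, Pi.sub_apply, h2, h3, he, h4, h1, Function.const_apply, ← sub_one_mul,
        norm_mul, mul_comm]
      exact mul_le_mul_of_nonneg_right (norm_indicator_le_norm_self _ _) (norm_nonneg _)
    · intro f g hf hg _ h1 h2
      refine squeeze_zero (fun _ => norm_nonneg _) (fun k => ?_) (by simpa using h1.add h2)
      rw [map_add, add_sub_add_comm]
      exact norm_add_le _ _

end Multiplication

/-- A measure whose multiples by `φ j (n k)` equidistribute in the annihilator of `G` makes `G` a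
rigidity group, through multiplication by `e ^ (2 π i x)` on `L²`. The circle is lifted to the
universe of the Hilbert space. -/
theorem isRigidityGroup_of_tendsto_integral {ℓ : ℕ} {φ : Fin ℓ → ℕ → ℤ}
    {G : AddSubgroup (Fin ℓ → ℤ)} {σ : Measure Torus} [IsProbabilityMeasure σ] {n : ℕ → ℕ}
    (hn : StrictMono n)
    (h : ∀ f : (Fin ℓ → Torus) → ℂ, Continuous f →
      Tendsto (fun k => ∫ x, f (fun j => φ j (n k) • x) ∂σ) atTop
        (𝓝 (∫ y, f y ∂(haarAnnihilator G)))) :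
    IsRigidityGroup.{u} φ G := by
  have hμ : IsProbabilityMeasure (σ.map (ULift.up.{u} : Torus → ULift Torus)) :=
    Measure.isProbabilityMeasure_map measurable_up.aemeasurable
  refine ⟨n, hn, Lp ℂ 2 (σ.map (ULift.up.{u} : Torus → ULift Torus)), inferInstance, inferInstance,
    inferInstance, mulCharacter _ measurable_down 1, ?_⟩
  ext a
  have hint : ∀ m : ℤ, ∫ y : ULift.{u} Torus, fourier m y.down ∂(σ.map ULift.up) =
      ∫ x, fourier m x ∂σ := fun m =>
    integral_map measurable_up.aemeasurable
      ((fourier m).continuous.measurable.comp measurable_down).aestronglyMeasurable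
  have hlim := h _ (UnitAddTorus.mFourier a).continuous
  simp only [mFourier_zsmul] at hlim
  rw [rigiditySet, Set.mem_ofPred_eq, tendsto_mulCharacter_zpow_iff]
  simp only [hint, SetLike.mem_coe]
  by_cases ha : a ∈ G
  · rw [integral_mFourier_haarAnnihilator_of_mem ha] at hlim
    exact iff_of_true ha hlim
  · rw [integral_mFourier_haarAnnihilator_of_notMem ha] at hlim
    exact iff_of_false ha fun h1 => zero_ne_one (tendsto_nhds_unique hlim h1)

/-- Along an asymptotic relation the power of `U` is eventually `U ^ 0`. -/
theorem IsRigidityGroup.asymptoticRelations_subset {ℓ : ℕ} {φ : Fin ℓ → ℕ → ℤ}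
    {G : AddSubgroup (Fin ℓ → ℤ)} (h : IsRigidityGroup.{u} φ G) :
    asymptoticRelations φ ⊆ (G : Set (Fin ℓ → ℤ)) := by
  obtain ⟨n, hn, H, _, _, _, U, hU⟩ := h
  rw [hU]
  intro a ha f
  refine tendsto_const_nhds.congr' ?_
  filter_upwards [hn.tendsto_atTop.eventually (tendsto_zero_iff_eventually_eq.mp ha)] with k hk
  simp [hk]

/-! ### Reduction to asymptotically linearly independent sequences -/

/-- Asymptotic linear independence of the sequences indexed by `S`. -/
def AsymptoticallyIndependentOn {ℓ : ℕ} (φ : Fin ℓ → ℕ → ℤ) (S : Finset (Fin ℓ)) : Prop :=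
  ∀ a : Fin ℓ → ℤ, (∀ j ∉ S, a j = 0) → a ∈ asymptoticRelationGroup φ → a = 0

theorem Adequate.asymptoticallyIndependentOn_singleton {ℓ : ℕ} {φ : Fin ℓ → ℕ → ℤ}
    (hφ : Adequate φ) (i : Fin ℓ) : AsymptoticallyIndependentOn φ {i} := by
  intro a hS ha
  rw [mem_asymptoticRelationGroup] at ha
  obtain ⟨n, hn, hn'⟩ := (ha.and ((hφ.1 i).eventually_gt_atTop 0)).exists
  rw [Finset.sum_eq_single i (fun j _ hj => by rw [hS j (by simpa using hj), zero_mul])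
    (by simp)] at hn
  ext j
  by_cases hj : j = i
  · subst hj
    exact (mul_eq_zero.mp hn).resolve_right (abs_pos.mp hn')
  · exact hS j (by simpa using hj)

/-- If `S` is a maximal independent set of indices, then a common multiple `M * d` of every integer
vector `d` agrees with a vector supported on `S`, up to asymptotic relations. -/
theorem exists_multiple_of_maximal {ℓ : ℕ} {φ : Fin ℓ → ℕ → ℤ} {S : Finset (Fin ℓ)}
    (hS : Maximal (AsymptoticallyIndependentOn φ) S) :
    ∃ M : ℕ, 1 ≤ M ∧ ∀ d : Fin ℓ → ℤ, ∃ b : Fin ℓ → ℤ, (∀ j ∉ S, b j = 0) ∧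
      b - (M : ℤ) • d ∈ asymptoticRelationGroup φ := by
  classical
  have hone : ∀ i, ∃ m : ℤ, m ≠ 0 ∧ ∃ b : Fin ℓ → ℤ, (∀ j ∉ S, b j = 0) ∧
      b - m • Pi.single i 1 ∈ asymptoticRelationGroup φ := by
    intro i
    by_cases hi : i ∈ S
    · refine ⟨1, one_ne_zero, Pi.single i 1, fun j hj => ?_, by simp⟩
      exact Pi.single_eq_of_ne (fun h : j = i => hj (h ▸ hi)) _
    · have hnot : ¬ AsymptoticallyIndependentOn φ (insert i S) := fun h =>
        hi (hS.le_of_ge h (Finset.subset_insert i S) (Finset.mem_insert_self i S))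
      simp only [AsymptoticallyIndependentOn, not_forall] at hnot
      obtain ⟨a, ha, haA, ha0⟩ := hnot
      refine ⟨- a i, ?_, a - a i • Pi.single i 1, fun j hj => ?_, by simpa using haA⟩
      · intro hai
        refine ha0 (hS.prop a (fun j hj => ?_) haA)
        by_cases hji : j = i
        · rw [hji]; exact neg_eq_zero.mp hai
        · exact ha j (by simp [hji, hj])
      · by_cases hji : j = i
        · subst hji; simp
        · simp [hji, ha j (by simp [hji, hj])]
  choose m hm0 b hbS hbA using hone
  refine ⟨(∏ i, m i).natAbs, Nat.one_le_iff_ne_zero.mpr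
    (Int.natAbs_ne_zero.mpr (Finset.prod_ne_zero_iff.mpr fun i _ => hm0 i)), fun d => ?_⟩
  have hdvd : ∀ i, ∃ q : ℤ, ((∏ i, m i).natAbs : ℤ) = m i * q := fun i =>
    Int.dvd_natAbs.mpr (Finset.dvd_prod_of_mem m (Finset.mem_univ i))
  choose q hq using hdvd
  refine ⟨∑ i, (q i * d i) • b i, fun j hj => ?_, ?_⟩
  · rw [Finset.sum_apply]
    exact Finset.sum_eq_zero fun i _ => by simp [hbS i j hj]
  · have hd : ((∏ i, m i).natAbs : ℤ) • d =
        ∑ i, (q i * d i) • (m i • (Pi.single i 1 : Fin ℓ → ℤ)) := by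
      conv_lhs => rw [← Finset.univ_sum_single d, Finset.smul_sum]
      refine Finset.sum_congr rfl fun i _ => ?_
      rw [hq i]
      ext j
      by_cases hj : j = i
      · subst hj; simp; ring
      · simp [hj]
    rw [hd, ← Finset.sum_sub_distrib]
    refine sum_mem fun i _ => ?_
    rw [← smul_sub]
    exact zsmul_mem (hbA i) _

/-- Extension by zero of a vector indexed by a subset of the indices. -/
def extendZero {c ℓ : ℕ} (J : Fin c → Fin ℓ) : (Fin c → ℤ) →+ (Fin ℓ → ℤ) where
  toFun a := ∑ r, a r • Pi.single (J r) 1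
  map_zero' := by simp
  map_add' a b := by simp [add_smul, Finset.sum_add_distrib]

theorem sum_extendZero_mul {c ℓ : ℕ} (J : Fin c → Fin ℓ) (a : Fin c → ℤ) (v : Fin ℓ → ℤ) :
    ∑ j, extendZero J a j * v j = ∑ r, a r * v (J r) := by
  simp only [extendZero, AddMonoidHom.coe_mk, ZeroHom.coe_mk, Finset.sum_apply, Pi.smul_apply,
    Finset.sum_mul]
  rw [Finset.sum_comm]
  refine Finset.sum_congr rfl fun r _ => ?_
  rw [Finset.sum_eq_single (J r) (fun j _ hj => by simp [hj]) (by simp)]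
  simp

theorem extendZero_apply {c ℓ : ℕ} {J : Fin c → Fin ℓ} (hJ : Function.Injective J)
    (a : Fin c → ℤ) (r : Fin c) : extendZero J a (J r) = a r := by
  simp only [extendZero, AddMonoidHom.coe_mk, ZeroHom.coe_mk, Finset.sum_apply, Pi.smul_apply]
  rw [Finset.sum_eq_single r (fun s _ hs => by simp [hJ.ne hs.symm]) (by simp)]
  simp

theorem extendZero_apply_of_notMem {c ℓ : ℕ} {J : Fin c → Fin ℓ} (a : Fin c → ℤ) {j : Fin ℓ}
    (hj : j ∉ Set.range J) : extendZero J a j = 0 := by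
  simp only [extendZero, AddMonoidHom.coe_mk, ZeroHom.coe_mk, Finset.sum_apply, Pi.smul_apply]
  refine Finset.sum_eq_zero fun r _ => ?_
  rw [Pi.single_eq_of_ne (fun h => hj ⟨r, h.symm⟩), smul_zero]

/-- Asymptotic equality of the combination `a` of the `φ (J r)` with `M` times the combination `d`
of all the `φ j` is membership in the group of asymptotic relations. -/
theorem tendsto_abs_sub_iff {c ℓ : ℕ} {φ : Fin ℓ → ℕ → ℤ} {J : Fin c → Fin ℓ} {M : ℕ}
    {a : Fin c → ℤ} {d : Fin ℓ → ℤ} :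
    Tendsto (fun k => |∑ r, a r * φ (J r) k - M * ∑ j, d j * φ j k|) atTop (𝓝 0) ↔
      extendZero J a - (M : ℤ) • d ∈ asymptoticRelationGroup φ := by
  rw [tendsto_abs_zero_iff_eventually_eq, mem_asymptoticRelationGroup]
  refine eventually_congr (Eventually.of_forall fun k => ?_)
  rw [← sum_extendZero_mul J a fun j => φ j k]
  simp only [Pi.sub_apply, Pi.smul_apply, smul_eq_mul, sub_mul, Finset.sum_sub_distrib,
    Finset.mul_sum, mul_assoc]

theorem mem_asymptoticRelationGroup_of_zsmul_mem {ℓ : ℕ} {φ : Fin ℓ → ℕ → ℤ} {a : Fin ℓ → ℤ}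
    {m : ℤ} (hm : m ≠ 0) (h : m • a ∈ asymptoticRelationGroup φ) :
    a ∈ asymptoticRelationGroup φ := by
  rw [mem_asymptoticRelationGroup] at h ⊢
  filter_upwards [h] with n hn
  simp only [Pi.smul_apply, smul_eq_mul, mul_assoc, ← Finset.mul_sum] at hn
  exact (mul_eq_zero.mp hn).resolve_left hm

/-- The reduction to independent sequences: `J` enumerates a maximal independent set of indices, and
`G'` consists of the vectors asymptotically equal to `M` times an element of `G`. -/
theorem Adequate.exists_independent_reduction {ℓ : ℕ} (hℓ : 0 < ℓ) {φ : Fin ℓ → ℕ → ℤ}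
    (hφ : Adequate φ) {G : AddSubgroup (Fin ℓ → ℤ)} (hG : asymptoticRelationGroup φ ≤ G) :
    ∃ (c : ℕ) (M : ℕ) (J : Fin c → Fin ℓ) (G' : AddSubgroup (Fin c → ℤ)),
      1 ≤ c ∧ c ≤ ℓ ∧ 1 ≤ M ∧ StrictMono J ∧
      AsymptoticallyLinearIndependent (fun r => φ (J r)) ∧
      (∀ d : Fin ℓ → ℤ, ∃ a : Fin c → ℤ,
        Tendsto (fun k => |∑ r, a r * φ (J r) k - M * ∑ j, d j * φ j k|) atTop (𝓝 0)) ∧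
      (∀ d : Fin ℓ → ℤ, d ∈ G ↔ ∀ a : Fin c → ℤ,
        Tendsto (fun k => |∑ r, a r * φ (J r) k - M * ∑ j, d j * φ j k|) atTop (𝓝 0) →
          a ∈ G') := by
  obtain ⟨S, hiS, hS⟩ := (Set.toFinite {S | AsymptoticallyIndependentOn φ S}).exists_le_maximal
    (hφ.asymptoticallyIndependentOn_singleton ⟨0, hℓ⟩)
  obtain ⟨M, hM, hspan⟩ := exists_multiple_of_maximal hS
  let J : Fin S.card → Fin ℓ := S.orderEmbOfFin rfl
  have hJ : StrictMono J := (S.orderEmbOfFin rfl).strictMono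
  have hrange : ∀ {j}, j ∉ Set.range J → j ∉ S := by
    intro j hj
    rwa [Finset.range_orderEmbOfFin] at hj
  have hex : ∀ d : Fin ℓ → ℤ, ∃ a : Fin S.card → ℤ,
      extendZero J a - (M : ℤ) • d ∈ asymptoticRelationGroup φ := by
    intro d
    obtain ⟨b, hb, hbA⟩ := hspan d
    refine ⟨fun r => b (J r), ?_⟩
    convert hbA using 2
    ext j
    by_cases hj : j ∈ Set.range J
    · obtain ⟨r, rfl⟩ := hj
      exact extendZero_apply hJ.injective _ r
    · rw [extendZero_apply_of_notMem _ hj, hb j (hrange hj)]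
  -- The preimage of `M • G + A`, where `A` is the group of asymptotic relations.
  let G' : AddSubgroup (Fin S.card → ℤ) :=
    ((G.map (zsmulAddGroupHom (M : ℤ))) ⊔ asymptoticRelationGroup φ).comap (extendZero J)
  have hmemG' : ∀ {a}, a ∈ G' ↔
      ∃ d ∈ G, extendZero J a - (M : ℤ) • d ∈ asymptoticRelationGroup φ := by
    intro a
    simp only [G', AddSubgroup.mem_comap, AddSubgroup.mem_sup, AddSubgroup.mem_map,
      exists_exists_and_eq_and, zsmulAddGroupHom_apply]
    constructor
    · rintro ⟨d, hd, z, hz, h⟩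
      exact ⟨d, hd, by rwa [← h, add_sub_cancel_left]⟩
    · rintro ⟨d, hd, h⟩
      exact ⟨d, hd, _, h, add_sub_cancel _ _⟩
  refine ⟨S.card, M, J, G', Finset.card_pos.mpr ⟨_, hiS (Finset.mem_singleton_self _)⟩,
    (Finset.card_le_univ S).trans_eq (Fintype.card_fin ℓ), hM, hJ, fun a ha => ?_, ?_, ?_⟩
  · have hnot : extendZero J a ∉ asymptoticRelationGroup φ := fun h => ha <| by
      have h0 : extendZero J a = 0 := hS.prop _ (fun j hj => extendZero_apply_of_notMem a
        (by rwa [Finset.range_orderEmbOfFin])) h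
      ext r
      rw [← extendZero_apply hJ.injective a r, h0]
      rfl
    simpa only [sum_extendZero_mul J a fun j => φ j _] using hφ.tendsto_of_notMem hnot
  · simpa only [tendsto_abs_sub_iff] using hex
  · intro d
    simp only [tendsto_abs_sub_iff]
    refine ⟨fun hd a ha => hmemG'.mpr ⟨d, hd, ha⟩, fun h => ?_⟩
    obtain ⟨a, ha⟩ := hex d
    obtain ⟨d', hd', ha'⟩ := hmemG'.mp (h a ha)
    have hdiff : (M : ℤ) • (d - d') ∈ asymptoticRelationGroup φ := by
      have := sub_mem ha' ha
      rwa [sub_sub_sub_cancel_left, ← smul_sub] at this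
    have := hG (mem_asymptoticRelationGroup_of_zsmul_mem (by omega) hdiff)
    simpa using add_mem this hd'

/-- For an asymptotic relation `d`, independence forces the vector `a` attached to `d` to vanish. -/
theorem asymptoticRelations_subset_of_reduction {c M ℓ : ℕ} {φ : Fin ℓ → ℕ → ℤ}
    {G : AddSubgroup (Fin ℓ → ℤ)} {J : Fin c → Fin ℓ} {G' : AddSubgroup (Fin c → ℤ)}
    (hJ : AsymptoticallyLinearIndependent fun r => φ (J r))
    (hG : ∀ d : Fin ℓ → ℤ, d ∈ G ↔ ∀ a : Fin c → ℤ,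
      Tendsto (fun k => |∑ r, a r * φ (J r) k - M * ∑ j, d j * φ j k|) atTop (𝓝 0) → a ∈ G') :
    asymptoticRelations φ ⊆ (G : Set (Fin ℓ → ℤ)) := by
  intro d hd
  refine (hG d).mpr fun a ha => ?_
  have hzero : a = 0 := by
    by_contra hne
    obtain ⟨k, h1, h2, h3⟩ := ((tendsto_abs_zero_iff_eventually_eq.mp ha).and
      ((tendsto_zero_iff_eventually_eq.mp hd).and
        ((hJ a hne).eventually_gt_atTop 0))).exists
    rw [h2, mul_zero, sub_zero] at h1
    simp [h1] at h3
  rw [hzero]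
  exact zero_mem _

/-! ### The equivalences -/

theorem theorem0 {ℓ : ℕ} (hℓ : 0 < ℓ) (φ : Fin ℓ → ℕ → ℤ) (hφ : Adequate φ)
    (G : AddSubgroup (Fin ℓ → ℤ)) :
    List.TFAE [
      -- item (i)
      IsRigidityGroup.{u} φ G,
      -- item (ii)
      asymptoticRelations φ ⊆ (G : Set (Fin ℓ → ℤ)),
      -- item (iii)
      ∃ (σ : Measure Torus) (_ : IsProbabilityMeasure σ) (n : ℕ → ℕ), StrictMono n ∧
        ∀ f : (Fin ℓ → Torus) → ℂ, Continuous f → ∀ E : Set Torus, MeasurableSet E →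
          Tendsto
            (fun k => ∫ x, E.indicator (fun _ => (1 : ℂ)) x * f (fun j => φ j (n k) • x) ∂σ)
            atTop (𝓝 ((σ.real E : ℂ) * ∫ y, f y ∂(haarAnnihilator G))),
      -- item (iv)
      ∃ (σ : Measure Torus) (_ : IsProbabilityMeasure σ) (n : ℕ → ℕ), StrictMono n ∧
        ∀ f : (Fin ℓ → Torus) → ℂ, Continuous f →
          Tendsto (fun k => ∫ x, f (fun j => φ j (n k) • x) ∂σ)
            atTop (𝓝 (∫ y, f y ∂(haarAnnihilator G))),
      -- item (v)
      ∃ (c : ℕ) (M : ℕ) (J : Fin c → Fin ℓ) (G' : AddSubgroup (Fin c → ℤ)),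
        1 ≤ c ∧ c ≤ ℓ ∧ 1 ≤ M ∧ StrictMono J ∧
        AsymptoticallyLinearIndependent (fun r => φ (J r)) ∧
        (∀ d : Fin ℓ → ℤ, ∃ a : Fin c → ℤ,
          Tendsto (fun k => |∑ r, a r * φ (J r) k - M * ∑ j, d j * φ j k|) atTop (𝓝 0)) ∧
        (∀ d : Fin ℓ → ℤ, d ∈ G ↔ ∀ a : Fin c → ℤ,
          Tendsto (fun k => |∑ r, a r * φ (J r) k - M * ∑ j, d j * φ j k|) atTop (𝓝 0) →
            a ∈ G')
    ] := by
  tfae_have 1 → 2 := fun h => h.asymptoticRelations_subset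
  tfae_have 2 → 3 := fun h => hφ.exists_measure_tendsto h
  tfae_have 3 → 4 := by
    rintro ⟨σ, hσ, n, hn, h⟩
    refine ⟨σ, hσ, n, hn, fun f hf => ?_⟩
    simpa using h f hf Set.univ MeasurableSet.univ
  tfae_have 4 → 1 := by
    rintro ⟨σ, hσ, n, hn, h⟩
    exact isRigidityGroup_of_tendsto_integral hn h
  tfae_have 2 → 5 := fun h => hφ.exists_independent_reduction hℓ h
  tfae_have 5 → 2 := by
    rintro ⟨c, M, J, G', -, -, -, -, hJ, -, hG⟩
    exact asymptoticRelations_subset_of_reduction hJ hG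
  tfae_finish
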